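/- **Conventions.** For a language $\mathcal L\supseteq\{\in\}$, $\mathrm{ZF}(\mathcal L)$ is the theory consisting of extensionality, foundation, pairing, union, power set, infinity, and the separation and collection schemes for all $\mathcal L$-formulas (with parameters); $\mathrm{ZFC}(\mathcal L)$ is $\mathrm{ZF}(\mathcal L)$ plus the axiom of choice. $\mathrm{GW}$ is the axiom "$<$ is a (strict) linear order of the universe and every nonempty set has a $<$-least element". For $k\ge 0$ let $\mathcal L_k=\{\in,<\}\cup\{I_j : j<k\}$, where $<$ is a binary and each $I_j$ a unary predicate symbol. For $k\geq 1$, $\mathrm{ZFI}^k_<$ is the $\mathcal L_k$-theory with the following axioms: 1. $\mathrm{ZF}(\mathcal L_j)$ for $1\le j\le k$, together with $\mathrm{GW}$ (and the axiom of choice if $k\ge 2$, so that $\mathrm{ZFC}(\mathcal L_j)$ holds for $2\le j\le k$); 2. for each $j<k$, $I_j$ is a cofinal subclass of the class $\mathrm{Ord}$ of ordinals; 3. for each $j<k$, $(I_j,\in)$ is a class of order indiscernibles for $(\mathrm V,\in,<,I_i)_{i<j}$: for every $n$ and every $\mathcal L_j$-formula $\varphi(v_1,\dots,v_n)$ without parameters,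 and all ordinals $x_1\in\cdots\in x_n$ and $y_1\in\cdots\in y_n$ from $I_j$, $\varphi(x_1,\dots,x_n)\leftrightarrow\varphi(y_1,\dots,y_n)$; 4. $I_{j+1}\subseteq I_{j}$ whenever $j+1<k$. $\mathrm{ZFI}^\omega_<$ is the union of the theories $\mathrm{ZFI}^k_<$ for $1\le k<\omega$. A model of $\mathrm{GBC}$ (Gödel–Bernays class theory with global choice) is a pair $(\mathcal M,\mathfrak X)$ such that $\mathcal M\models \mathrm{ZF}$, $\mathfrak X\subseteq\mathcal P(M)$, and the following hold, with the members of $\mathfrak X$ as the classes: comprehension for formulas that may have set and class parameters but quantify over sets only; every nonempty class has an $\in$-minimal element; the image of a set under a class function is a set; and there is a class function choosing an element from every nonempty set. Relations and functions are coded as classes of ordered pairs. An *$\mathrm{Ord}$-tree* is a class $\tau$ with a class relation $<_\tau$ that is a well-founded tree of height $\mathrm{Ord}$ (every node has an ordinal rank, namely the ordinal isomorphic to the $<_\tau$-ordered set of its predecessors, and every ordinal is the rank of some node) such that for each ordinal $\alpha$ the nodes of rank $\alpha$ form a set. A *branch* of such a tree is a downward closed, linearly ordered class of nodes that contains a node of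 every ordinal rank. "$\mathrm{Ord}$ is weakly compact" is the assertion that every $\mathrm{Ord}$-tree has a branch. **Theorem.** Let $\widehat{\mathcal M}=(\mathcal M,<_M,I_k)_{k\in\omega}$ be a model of $\mathrm{ZFI}^\omega_<$, and let $\mathfrak X$ be the collection of all subsets of $M$ that are definable in $\widehat{\mathcal M}$ with parameters from $M$. Then $$(\mathcal M,\mathfrak X)\models \mathrm{GBC}+\text{"}\mathrm{Ord}\text{ is weakly compact"}.$$ -/

import Mathlib

open FirstOrder

namespace ZFIndis

/-- Relation symbols: the binary symbol `∈`, further binary symbols indexed by `B`, and unary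
predicate symbols indexed by `U`. -/
inductive Symb (B U : Type) : ℕ → Type
  | mem : Symb B U 2
  | bin (b : B) : Symb B U 2
  | un (u : U) : Symb B U 1

/-- The language of set theory expanded by binary symbols indexed by `B` and unary predicate
symbols indexed by `U`; there are no function symbols. -/
def lang (B U : Type) : Language where
  Functions := fun _ => Empty
  Relations := Symb B U

section Models

variable {M : Type*}

/-- The structure `(M, E, R_b, P_u)`, where `∈` is interpreted by `E`. -/
@[reducible] def str {B U : Type} (E : M → M → Prop) (R : B → M → M → Prop) (P : U → Set M) :
    (lang B U).Structure M where
  funMap := fun f => nomatch f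
  RelMap := fun r => match r with
    | Symb.mem => fun v => E (v 0) (v 1)
    | Symb.bin b => fun v => R b (v 0) (v 1)
    | Symb.un u => fun v => v 0 ∈ P u

/-- `(M, E, R, P) ⊨ φ[v]`. -/
def Holds {B U : Type} (E : M → M → Prop) (R : B → M → M → Prop) (P : U → Set M) {α : Type}
    (φ : (lang B U).Formula α) (v : α → M) : Prop :=
  @Language.Formula.Realize (lang B U) M (str E R P) α φ v

/-- The family of subsets of `M` that are definable in `(M, E, R, P)` with parameters from `M`. -/
def definableClasses {B U : Type} (E : M → M → Prop) (R : B → M → M → Prop) (P : U → Set M) :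
    Set (Set M) :=
  {X | @Set.Definable₁ M Set.univ (lang B U) (str E R P) X}

/-- The axioms of `ZF` other than the two schemes; `E x y` is read as `x ∈ y`. -/
structure BasicAxioms (E : M → M → Prop) : Prop where
  extensionality : ∀ a b, (∀ x, E x a ↔ E x b) → a = b
  foundation : ∀ a, (∃ x, E x a) → ∃ x, E x a ∧ ∀ y, E y x → ¬ E y a
  pairing : ∀ a b, ∃ c, ∀ x, E x c ↔ x = a ∨ x = b
  union : ∀ a, ∃ b, ∀ x, E x b ↔ ∃ y, E y a ∧ E x y
  powerset : ∀ a, ∃ b, ∀ x, E x b ↔ ∀ y, E y x → E y a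
  infinity : ∃ w, (∃ z, E z w ∧ ∀ x, ¬ E x z) ∧
    ∀ x, E x w → ∃ y, E y w ∧ ∀ u, E u y ↔ E u x ∨ u = x

/-- `(M, E, R, P) ⊨ ZF(𝓛)` for `𝓛 = lang B U`: separation and collection are postulated for all
`𝓛`-formulas, with finitely many parameters. -/
structure ModelsZF {B U : Type} (E : M → M → Prop) (R : B → M → M → Prop) (P : U → Set M) :
    Prop where
  basic : BasicAxioms E
  separation : ∀ (n : ℕ) (φ : (lang B U).Formula (Fin (n + 1))) (y : Fin n → M) (v : M),
    ∃ w, ∀ x, E x w ↔ E x v ∧ Holds E R P φ (Fin.cons x y)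
  collection : ∀ (n : ℕ) (φ : (lang B U).Formula (Fin (n + 2))) (z : Fin n → M) (v : M),
    (∀ x, E x v → ∃ y, Holds E R P φ (Fin.cons x (Fin.cons y z))) →
      ∃ w, ∀ x, E x v → ∃ y, E y w ∧ Holds E R P φ (Fin.cons x (Fin.cons y z))

/-- The axiom of choice: every set of nonempty pairwise disjoint sets has a choice set. -/
def Choice (E : M → M → Prop) : Prop :=
  ∀ a, (∀ x, E x a → ∃ u, E u x) →
    (∀ x y, E x a → E y a → (∃ u, E u x ∧ E u y) → x = y) →
      ∃ c, ∀ x, E x a → ∃! u, E u x ∧ E u c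

/-- Global well-ordering: `lt` is a (strict) linear order of the universe and every nonempty set
has an `lt`-least element. -/
structure GlobalWellOrder (E lt : M → M → Prop) : Prop where
  irrefl : ∀ x, ¬ lt x x
  trans : ∀ x y z, lt x y → lt y z → lt x z
  total : ∀ x y, lt x y ∨ x = y ∨ lt y x
  least : ∀ a, (∃ x, E x a) → ∃ x, E x a ∧ ∀ y, E y a → y = x ∨ lt x y

/-- `a` is an ordinal of `(M, E)`: it is transitive and well-ordered by `∈`. -/
structure IsOrd (E : M → M → Prop) (a : M) : Prop where
  transitive : ∀ x, E x a → ∀ y, E y x → E y a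
  irrefl : ∀ x, E x a → ¬ E x x
  trans : ∀ x y z, E x a → E y a → E z a → E x y → E y z → E x z
  total : ∀ x y, E x a → E y a → E x y ∨ x = y ∨ E y x
  least : ∀ s, (∀ x, E x s → E x a) → (∃ x, E x s) → ∃ x, E x s ∧ ∀ y, E y s → y = x ∨ E x y

/-- `I` is a cofinal subclass of the class of ordinals. -/
def Cofinal (E : M → M → Prop) (I : Set M) : Prop :=
  (∀ i ∈ I, IsOrd E i) ∧ ∀ a, IsOrd E a → ∃ i ∈ I, E a i

/-- `(I, ∈)` is a class of order indiscernibles for `(M, E, R, P)`. The formulas `φ` carry no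
parameters. -/
def Indiscernible {B U : Type} (E : M → M → Prop) (R : B → M → M → Prop) (P : U → Set M)
    (I : Set M) : Prop :=
  ∀ (n : ℕ) (φ : (lang B U).Formula (Fin n)) (x y : Fin n → M),
    (∀ i, x i ∈ I) → (∀ i, y i ∈ I) →
    (∀ i j, i < j → E (x i) (x j)) → (∀ i j, i < j → E (y i) (y j)) →
      (Holds E R P φ x ↔ Holds E R P φ y)

/-- `(M, E, lt, I₀, …, I_{k-1})` is a model of `ZFI_<^k` (for `k ≥ 1`). For each `j`, the language
`𝓛_j` has the symbols `∈`, `<` and `I_i` for `i < j`. -/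
structure ModelsZFIk (k : ℕ) (E lt : M → M → Prop) (I : ℕ → Set M) : Prop where
  zf : ∀ j, 1 ≤ j → j ≤ k → ModelsZF E (fun _ : Unit => lt) (fun i : Fin j => I i)
  choice : 2 ≤ k → Choice E
  globalWellOrder : GlobalWellOrder E lt
  cofinal : ∀ j, j < k → Cofinal E (I j)
  indiscernible : ∀ j, j < k →
    Indiscernible E (fun _ : Unit => lt) (fun i : Fin j => I i) (I j)
  nested : ∀ j, j + 1 < k → I (j + 1) ⊆ I j

/-- `(M, E, lt, I_k)_{k ∈ ω}` is a model of `ZFI_<^ω`, the union of the theories `ZFI_<^k` for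
`k ≥ 1`. -/
def ModelsZFIomega (E lt : M → M → Prop) (I : ℕ → Set M) : Prop :=
  ∀ k, 1 ≤ k → ModelsZFIk k E lt I

/-- In `(M, E)`, `p` is the Kuratowski pair `{{x}, {x, y}}`. -/
def IsPair (E : M → M → Prop) (x y p : M) : Prop :=
  ∀ z, E z p ↔ (∀ u, E u z ↔ u = x) ∨ (∀ u, E u z ↔ u = x ∨ u = y)

/-- The binary relation coded by a class `F` of ordered pairs: `⟨x, y⟩ ∈ F`. -/
def ClassRel (E : M → M → Prop) (F : Set M) (x y : M) : Prop :=
  ∃ p ∈ F, IsPair E x y p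

/-- The binary relation coded by a set `f` of ordered pairs: `⟨x, y⟩ ∈ f`. -/
def SetRel (E : M → M → Prop) (f x y : M) : Prop :=
  ClassRel E {p | E p f} x y

/-- `(M, 𝔛)` is a model of Gödel–Bernays class theory with global choice; the classes are the
members of `𝔛`, so extensionality for classes is automatic. -/
structure ModelsGBC (E : M → M → Prop) (𝔛 : Set (Set M)) : Prop where
  /-- The sets form a model of `ZF`, in the pure language of set theory. -/
  zf : ModelsZF E (Empty.elim : Empty → M → M → Prop) (Empty.elim : Empty → Set M)
  /-- Comprehension for formulas with set and class parameters that quantify over sets only. -/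
  comprehension : ∀ (m n : ℕ) (φ : (lang Empty (Fin m)).Formula (Fin (n + 1)))
    (C : Fin m → Set M) (y : Fin n → M), (∀ i, C i ∈ 𝔛) →
      {x | Holds E (Empty.elim : Empty → M → M → Prop) C φ (Fin.cons x y)} ∈ 𝔛
  /-- Every nonempty class has an `∈`-minimal element. -/
  foundation : ∀ X ∈ 𝔛, X.Nonempty → ∃ x ∈ X, ∀ y, E y x → y ∉ X
  /-- The image of a set under a class function is a set. -/
  replacement : ∀ F ∈ 𝔛, (∀ x y y', ClassRel E F x y → ClassRel E F x y' → y = y') →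
    ∀ a, ∃ b, ∀ y, E y b ↔ ∃ x, E x a ∧ ClassRel E F x y
  /-- Some class function chooses an element from every nonempty set. -/
  globalChoice : ∃ F ∈ 𝔛, (∀ x y y', ClassRel E F x y → ClassRel E F x y' → y = y') ∧
    ∀ x, (∃ u, E u x) → ∃ y, E y x ∧ ClassRel E F x y

/-- The node `t` of the tree ordered by `r` has rank (the ordinal) `a`: some set is (the graph of)
an isomorphism of `(a, ∈)` with the predecessors of `t` ordered by `r`. -/
def HasRank (E r : M → M → Prop) (t a : M) : Prop :=
  IsOrd E a ∧ ∃ f,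
    (∀ x s, SetRel E f x s → E x a ∧ r s t) ∧
    (∀ x, E x a → ∃! s, SetRel E f x s) ∧
    (∀ s, r s t → ∃! x, SetRel E f x s) ∧
    (∀ x y s u, SetRel E f x s → SetRel E f y u → (E x y ↔ r s u))

/-- `(τ, r)` is an `Ord`-tree: a well-founded tree of height `Ord` each of whose levels is a
set. -/
structure IsOrdTree (E : M → M → Prop) (τ : Set M) (r : M → M → Prop) : Prop where
  field : ∀ s t, r s t → s ∈ τ ∧ t ∈ τ
  irrefl : ∀ t, ¬ r t t
  trans : ∀ s t u, r s t → r t u → r s u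
  linear_below : ∀ s u t, r s t → r u t → r s u ∨ s = u ∨ r u s
  wellFounded : ∀ a, (∃ t, E t a) → (∀ t, E t a → t ∈ τ) →
    ∃ t, E t a ∧ ∀ s, E s a → ¬ r s t
  /-- Every node has an ordinal rank, and every ordinal is the rank of a node. -/
  rank_of_node : ∀ t ∈ τ, ∃ a, HasRank E r t a
  node_of_rank : ∀ a, IsOrd E a → ∃ t ∈ τ, HasRank E r t a
  level_isSet : ∀ a, IsOrd E a → ∃ c, ∀ t, E t c ↔ t ∈ τ ∧ HasRank E r t a

/-- `b` is a (cofinal) branch of `(τ, r)`: a downward closed chain that meets every level. -/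
structure IsBranch (E : M → M → Prop) (τ : Set M) (r : M → M → Prop) (b : Set M) : Prop where
  subset : b ⊆ τ
  chain : ∀ s ∈ b, ∀ t ∈ b, r s t ∨ s = t ∨ r t s
  downward : ∀ t ∈ b, ∀ s, r s t → s ∈ b
  cofinal : ∀ a, IsOrd E a → ∃ t ∈ b, HasRank E r t a

/-- `(M, 𝔛) ⊨ “Ord is weakly compact”`: every `Ord`-tree has a branch. -/
def OrdWeaklyCompact (E : M → M → Prop) (𝔛 : Set (Set M)) : Prop :=
  ∀ τ ∈ 𝔛, ∀ r ∈ 𝔛, IsOrdTree E τ (ClassRel E r) → ∃ b ∈ 𝔛, IsBranch E τ (ClassRel E r) b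

end Models

end ZFIndis

/-! A formula mentions finitely many symbols, so every definable class is definable from parameters
and the `I j` with `j < k`, for some `k`. Hence each instance of separation or collection in the
full language holds in some reduct, and the full structure satisfies both schemes. GBC follows:
foundation for classes comes from transitive closures, replacement from collection and separation,
and global choice by taking `lt`-least elements.

For weak compactness, let a tree be definable from the `I j` with `j < k` and one parameter `p`
(finitely many parameters are coded by iterated pairs). Put `J = I k`, a cofinal class of
indiscernibles for that reduct, and for `b ∈ J` let `t_b` be the `lt`-least node of rank `b`. The
branch consists of the nodes that lie below `t_b` for all sufficiently large `b ∈ J`. Two such nodes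
lie below a common `t_b`, so they are comparable. To meet level `a`, choose `i ∈ J` above `a` and
above the ranks of the pairs `⟨p, s⟩` collected for the nodes `s` of that level. The predecessor at
level `a` of one `t_b` with `b > i` is then below every such `t_b`, provided that elements of `J`
above `i` are indiscernible over parameters of rank below `i`.

That is `ModelsZF.indiscernible_parameters`. "`b` and `c` satisfy `S` with the same parameters of
rank below `i`" is a parameter-free condition on `i < b < c`, so it holds for all increasing triples
from `J` or for none. If it held for none, different `b` would have different traces inside one set,
and the unbounded class `J` would inject into a power set, contrary to collection. -/

namespace ZFIndis

/-! ### Calculus of definable relations -/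

section Definability

variable {M : Type*} {B U : Type}

/-- The relation `Q` on `M` is definable in `(M, E, R, P)` with parameters from `A`. -/
class Dfn (E : M → M → Prop) (R : B → M → M → Prop) (P : U → Set M) (A : Set M) {α : Type}
    (Q : (α → M) → Prop) : Prop where
  out : @Set.Definable M A (lang B U) (str E R P) α {v | Q v}

/-- `f` is a variable or a parameter from `A`. -/
class Tm (A : Set M) {α : Type} (f : (α → M) → M) : Prop where
  out : (∃ i, ∀ v, f v = v i) ∨ ∃ a ∈ A, ∀ v, f v = a

instance Tm.var (A : Set M) {α : Type} (i : α) : Tm A (fun v : α → M => v i) :=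
  ⟨Or.inl ⟨i, fun _ => rfl⟩⟩

instance Tm.const {α : Type} (a : M) : Tm Set.univ (fun _ : α → M => a) :=
  ⟨Or.inr ⟨a, trivial, fun _ => rfl⟩⟩

instance Tm.const_singleton {α : Type} (a : M) : Tm {a} (fun _ : α → M => a) :=
  ⟨Or.inr ⟨a, rfl, fun _ => rfl⟩⟩

namespace Dfn

variable {E : M → M → Prop} {R : B → M → M → Prop} {P : U → Set M} {A : Set M} {α : Type}

theorem congr {Q Q' : (α → M) → Prop} (h : ∀ v, Q v ↔ Q' v) (hQ : Dfn E R P A Q) :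
    Dfn E R P A Q' := by
  rwa [← show Q = Q' from funext fun v => propext (h v)]

theorem mono {A' : Set M} (hA : A ⊆ A') {Q : (α → M) → Prop} (hQ : Dfn E R P A Q) :
    Dfn E R P A' Q :=
  let := str E R P
  ⟨hQ.out.mono hA⟩

instance and (Q Q' : (α → M) → Prop) [hQ : Dfn E R P A Q] [hQ' : Dfn E R P A Q'] :
    Dfn E R P A (fun v => Q v ∧ Q' v) :=
  let := str E R P
  ⟨hQ.out.inter hQ'.out⟩

instance or (Q Q' : (α → M) → Prop) [hQ : Dfn E R P A Q] [hQ' : Dfn E R P A Q'] :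
    Dfn E R P A (fun v => Q v ∨ Q' v) :=
  let := str E R P
  ⟨hQ.out.union hQ'.out⟩

instance not (Q : (α → M) → Prop) [hQ : Dfn E R P A Q] : Dfn E R P A (fun v => ¬ Q v) :=
  let := str E R P
  ⟨hQ.out.compl⟩

instance imp (Q Q' : (α → M) → Prop) [Dfn E R P A Q] [Dfn E R P A Q'] :
    Dfn E R P A (fun v => Q v → Q' v) :=
  congr (fun v => (imp_iff_not_or (a := Q v) (b := Q' v)).symm) inferInstance

instance iff (Q Q' : (α → M) → Prop) [Dfn E R P A Q] [Dfn E R P A Q'] :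
    Dfn E R P A (fun v => Q v ↔ Q' v) :=
  congr (fun v => (iff_def (a := Q v) (b := Q' v)).symm) inferInstance

instance ex (Q : (α → M) → M → Prop)
    [hQ : Dfn E R P A (fun w : α ⊕ Unit → M => Q (fun i => w (.inl i)) (w (.inr ())))] :
    Dfn E R P A (fun v => ∃ x, Q v x) :=
  let := str E R P
  congr (fun _ => ⟨fun ⟨u, hu⟩ => ⟨u (), hu⟩, fun ⟨x, hx⟩ => ⟨fun _ => x, hx⟩⟩)
    ⟨hQ.out.exists_of_finite⟩

instance all (Q : (α → M) → M → Prop)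
    [hQ : Dfn E R P A (fun w : α ⊕ Unit → M => Q (fun i => w (.inl i)) (w (.inr ())))] :
    Dfn E R P A (fun v => ∀ x, Q v x) :=
  let := str E R P
  congr (fun _ => ⟨fun h x => h fun _ => x, fun h (u : Unit → M) => h (u ())⟩)
    ⟨hQ.out.forall_of_finite⟩

instance exUnique (Q : (α → M) → M → Prop)
    [Dfn E R P A (fun v => ∃ x, Q v x ∧ ∀ y, Q v y → y = x)] :
    Dfn E R P A (fun v => ∃! x, Q v x) :=
  ‹Dfn E R P A (fun v => ∃ x, Q v x ∧ ∀ y, Q v y → y = x)›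

/-- Without function symbols every term is a variable or a parameter, so substitution is a
relabelling of the defining formula. -/
theorem subst {β : Type} {Q : (β → M) → Prop} (hQ : Dfn E R P A Q) (f : β → (α → M) → M)
    (hf : ∀ b, Tm A (f b)) : Dfn E R P A (fun v => Q (fun b => f b v)) := by
  let := str E R P
  obtain ⟨φ, hφ⟩ := Set.definable_iff_exists_formula_sum.1 hQ.out
  have : ∀ b, ∃ c : A ⊕ α, ∀ v, f b v = Sum.elim (fun a : A => (a : M)) v c := fun b => by
    rcases (hf b).out with ⟨i, h⟩ | ⟨a, ha, h⟩
    · exact ⟨.inr i, h⟩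
    · exact ⟨.inl ⟨a, ha⟩, h⟩
  choose g hg using this
  refine ⟨Set.definable_iff_exists_formula_sum.2 ⟨φ.relabel (Sum.elim Sum.inl g), ?_⟩⟩
  ext v
  have h1 := Set.ext_iff.1 hφ fun b => f b v
  refine h1.trans ?_
  simp only [Set.mem_ofPred_eq, Language.Formula.realize_relabel]
  refine iff_of_eq (congrArg _ ?_)
  funext c
  rcases c with a | b
  · rfl
  · simp [hg]

theorem ofFormula (φ : (lang B U).Formula α) : Dfn E R P A (fun v => Holds E R P φ v) :=
  let := str E R P
  ⟨(Set.empty_definable_iff.2 ⟨φ, rfl⟩).mono (Set.empty_subset _)⟩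

theorem exists_formula {Q : (α → M) → Prop} (hQ : Dfn E R P ∅ Q) :
    ∃ φ : (lang B U).Formula α, ∀ v, Holds E R P φ v ↔ Q v := by
  let := str E R P
  obtain ⟨φ, hφ⟩ := Set.empty_definable_iff.1 hQ.out
  refine ⟨φ, fun v => ?_⟩
  exact (Set.ext_iff.1 hφ v).symm

theorem eq_var : Dfn E R P A (fun v : Fin 2 → M => v 0 = v 1) := by
  let := str E R P
  refine congr ?_ (ofFormula ((Language.Term.var (0 : Fin 2)).equal (Language.Term.var 1)))
  intro v
  simp [Holds]

theorem mem_var : Dfn E R P A (fun v : Fin 2 → M => E (v 0) (v 1)) := by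
  let := str E R P
  refine congr ?_ (ofFormula (Language.Relations.formula (L := lang B U) (n := 2) Symb.mem
    (fun i => Language.Term.var i)))
  intro v
  exact Language.Formula.realize_rel

theorem bin_var (b : B) : Dfn E R P A (fun v : Fin 2 → M => R b (v 0) (v 1)) := by
  let := str E R P
  refine congr ?_ (ofFormula (Language.Relations.formula (L := lang B U) (n := 2) (Symb.bin b)
    (fun i => Language.Term.var i)))
  intro v
  exact Language.Formula.realize_rel

theorem un_var (u : U) : Dfn E R P A (fun v : Fin 1 → M => v 0 ∈ P u) := by
  let := str E R P
  refine congr ?_ (ofFormula (Language.Relations.formula (L := lang B U) (n := 1) (Symb.un u)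
    (fun i => Language.Term.var i)))
  intro v
  exact Language.Formula.realize_rel

theorem subst₁ {Q : M → Prop} (hQ : Dfn E R P A (fun v : Fin 1 → M => Q (v 0)))
    (f : (α → M) → M) [hf : Tm A f] : Dfn E R P A (fun v => Q (f v)) :=
  hQ.subst (fun _ => f) fun _ => hf

theorem subst₂ {Q : M → M → Prop} (hQ : Dfn E R P A (fun v : Fin 2 → M => Q (v 0) (v 1)))
    (f g : (α → M) → M) [hf : Tm A f] [hg : Tm A g] : Dfn E R P A (fun v => Q (f v) (g v)) :=
  hQ.subst (fun i => if i = 0 then f else g) (by intro i; split <;> assumption)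

instance eq (f g : (α → M) → M) [Tm A f] [Tm A g] : Dfn E R P A (fun v => f v = g v) :=
  subst₂ eq_var f g

instance mem (f g : (α → M) → M) [Tm A f] [Tm A g] : Dfn E R P A (fun v => E (f v) (g v)) :=
  subst₂ mem_var f g

theorem bin (b : B) (f g : (α → M) → M) [Tm A f] [Tm A g] :
    Dfn E R P A (fun v => R b (f v) (g v)) :=
  subst₂ (bin_var b) f g

instance lt {lt : M → M → Prop} (f g : (α → M) → M) [Tm A f] [Tm A g] :
    Dfn E (fun _ : Unit => lt) P A (fun v => lt (f v) (g v)) :=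
  bin () f g

instance un (u : U) (f : (α → M) → M) [Tm A f] : Dfn E R P A (fun v => f v ∈ P u) :=
  subst₁ (un_var u) f

/-- Definability in the reducts of a structure, or in a structure whose relations interpret those
of the given language. -/
theorem interp {ι B' U' : Type} {V : ι → Type} {𝓕 : Filter ι} {P : ∀ i, V i → Set M}
    {R' : B' → M → M → Prop} {P' : U' → Set M}
    (hR : ∀ b, ∀ᶠ i in 𝓕, Dfn E R (P i) A (fun v : Fin 2 → M => R' b (v 0) (v 1)))
    (hP : ∀ u, ∀ᶠ i in 𝓕, Dfn E R (P i) A (fun v : Fin 1 → M => v 0 ∈ P' u))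
    {n : ℕ} (φ : (lang B' U').BoundedFormula α n) :
    ∀ᶠ i in 𝓕, Dfn E R (P i) A (fun v : α ⊕ Fin n → M =>
      @Language.BoundedFormula.Realize _ _ (str E R' P') _ _ φ
        (fun a => v (.inl a)) (fun k => v (.inr k))) := by
  let := str E R' P'
  have term : ∀ {n : ℕ} (t : (lang B' U').Term (α ⊕ Fin n)), Tm A (fun v : α ⊕ Fin n → M =>
      t.realize (Sum.elim (fun a => v (.inl a)) (fun k => v (.inr k)))) := by
    intro n t
    cases t with
    | var c =>
      rcases c with a | k
      · exact Tm.var _ (Sum.inl a)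
      · exact Tm.var _ (Sum.inr k)
    | func f => cases f
  induction φ with
  | falsum =>
    exact .of_forall fun i => ⟨let := str E R (P i); Set.definable_empty⟩
  | equal t s =>
    have := term t
    have := term s
    exact .of_forall fun i => eq _ _
  | @rel n l r ts =>
    cases r with
    | mem =>
      have := term (ts 0)
      have := term (ts 1)
      exact .of_forall fun i => mem _ _
    | bin b =>
      have := term (ts 0)
      have := term (ts 1)
      exact (hR b).mono fun i hi => subst₂ (Q := R' b) hi _ _
    | un u =>
      have := term (ts 0)
      exact (hP u).mono fun i hi => subst₁ (Q := fun x => x ∈ P' u) hi _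
  | imp φ ψ h h' =>
    -- Filters are closed under finite intersections. This is where the finiteness of formulas
    -- enters: each symbol only has to be interpretable eventually.
    filter_upwards [h, h'] with i hi hi'
    exact imp _ _
  | @all n φ h =>
    filter_upwards [h] with i hi
    refine @all _ _ _ _ _ _ _ _ (fun (v : α ⊕ Fin n → M) x =>
      @Language.BoundedFormula.Realize _ _ (str E R' P') _ _ φ (fun a => v (.inl a)) (Fin.snoc (fun k => v (.inr k)) x)) ?_
    refine congr ?_ (hi.subst (α := (α ⊕ Fin n) ⊕ Unit) (fun c (w : (α ⊕ Fin n) ⊕ Unit → M) =>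
      Sum.elim (fun a => w (.inl (.inl a)))
      (Fin.snoc (α := fun _ => M) (fun k => w (.inl (.inr k))) (w (.inr ()))) c) ?_)
    · intro v
      exact Iff.rfl
    · rintro (a | k)
      · exact Tm.var _ _
      · refine Fin.lastCases ?_ (fun k => ?_) k
        · simp only [Sum.elim_inr, Fin.snoc_last]; infer_instance
        · simp only [Sum.elim_inr, Fin.snoc_castSucc]; infer_instance

theorem interp_formula {ι B' U' : Type} {V : ι → Type} {𝓕 : Filter ι} {P : ∀ i, V i → Set M}
    {R' : B' → M → M → Prop} {P' : U' → Set M}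
    (hR : ∀ b, ∀ᶠ i in 𝓕, Dfn E R (P i) A (fun v : Fin 2 → M => R' b (v 0) (v 1)))
    (hP : ∀ u, ∀ᶠ i in 𝓕, Dfn E R (P i) A (fun v : Fin 1 → M => v 0 ∈ P' u))
    (φ : (lang B' U').Formula α) : ∀ᶠ i in 𝓕, Dfn E R (P i) A (fun v => Holds E R' P' φ v) := by
  filter_upwards [interp hR hP φ] with i hi
  refine congr ?_ (hi.subst (α := α) (fun c v => Sum.elim v finZeroElim c) ?_)
  · intro v
    simp only [Holds, Language.Formula.Realize]
    exact iff_of_eq (congrArg _ (Subsingleton.elim _ _))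
  · rintro (a | k)
    · exact Tm.var _ _
    · exact k.elim0

/-- If the parameters in `A` are definable from `A'`, then `A`-definable relations are
`A'`-definable. -/
theorem trans {A : Finset M} {A' : Set M} (hA : ∀ a ∈ A, Dfn E R P A' (fun v : Fin 1 → M => v 0 = a))
    {Q : (α → M) → Prop} (hQ : Dfn E R P (A : Set M) Q) : Dfn E R P A' Q := by
  let := str E R P
  obtain ⟨φ, hφ⟩ := Set.definable_iff_exists_formula_sum.1 hQ.out
  let g := A.equivFin
  -- Each parameter from `A` becomes a fresh variable, pinned by its definition over `A'`; these
  -- variables are then quantified existentially.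
  have h1 : Dfn E R P A'
      (fun w : α ⊕ Fin A.card → M => ∀ i, w (.inr i) = (g.symm i : M)) := by
    have := Set.definable_iInter_of_finite (ι := Fin A.card) (A := A') (L := lang B U)
      (f := fun i => {w : α ⊕ Fin A.card → M | w (.inr i) = (g.symm i : M)})
      fun i => (subst₁ (Q := fun x => x = (g.symm i : M)) (hA _ (g.symm i).2)
        fun w : α ⊕ Fin A.card → M => w (.inr i)).out
    refine ⟨?_⟩
    convert this
    ext w
    simp
  have h2 : Dfn E R P A' (fun w : α ⊕ Fin A.card → M =>
      Holds E R P (φ.relabel (Sum.map g id)) (fun c => w c.swap)) :=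
    (ofFormula _).subst _ fun b => Tm.var _ _
  refine congr ?_ ⟨(and _ _ (hQ := h1) (hQ' := h2)).out.exists_of_finite⟩
  intro v
  refine Iff.trans ?_ (Set.ext_iff.1 hφ v).symm
  have h4 : ∀ u : Fin A.card → M, (fun c : Fin A.card ⊕ α => Sum.elim v u c.swap) ∘ Sum.map g id =
      Sum.elim (u ∘ g) v := by
    intro u
    funext c
    rcases c with a | a <;> rfl
  simp only [Set.mem_ofPred_eq, Sum.elim_inr, Holds, Language.Formula.realize_relabel, h4]
  constructor
  · rintro ⟨u, hu, h⟩
    have : u ∘ g = fun a : A => (a : M) := by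
      funext a
      simp [hu]
    rwa [this] at h
  · intro h
    refine ⟨fun i => g.symm i, fun _ => rfl, ?_⟩
    have : (fun i => (g.symm i : M)) ∘ g = fun a : A => (a : M) := by
      funext a
      simp
    rwa [this]

end Dfn
end Definability
end ZFIndis
namespace ZFIndis

/-! ### Separation and collection for definable relations -/

section SetTheory

variable {M : Type*} {B U : Type} {E : M → M → Prop} {R : B → M → M → Prop} {P : U → Set M}

theorem Dfn.exists_parameters {α : Type} {Q : (α → M) → Prop} (hQ : Dfn E R P Set.univ Q) :
    ∃ (n : ℕ) (φ : (lang B U).Formula (α ⊕ Fin n)) (y : Fin n → M),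
      ∀ v, Holds E R P φ (Sum.elim v y) ↔ Q v := by
  let := str E R P
  obtain ⟨A, -, hA⟩ := Set.definable_iff_finitely_definable.1 hQ.out
  obtain ⟨φ, hφ⟩ := Set.definable_iff_exists_formula_sum.1 hA
  let g := A.equivFin
  refine ⟨A.card, φ.relabel (Sum.elim (fun a => Sum.inr (g a)) Sum.inl),
    fun i => (g.symm i : M), fun v => ?_⟩
  refine Iff.trans ?_ (Set.ext_iff.1 hφ v).symm
  simp only [Holds, Language.Formula.realize_relabel]
  refine iff_of_eq (congrArg _ ?_)
  funext c
  rcases c with a | a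
  · simp
  · rfl

namespace ModelsZF

variable (h : ModelsZF E R P)
include h

theorem sep (Q : M → Prop) [hQ : Dfn E R P Set.univ (fun v : Fin 1 → M => Q (v 0))] (v : M) :
    ∃ w, ∀ x, E x w ↔ E x v ∧ Q x := by
  obtain ⟨n, φ, y, hφ⟩ := hQ.exists_parameters
  obtain ⟨w, hw⟩ := h.separation n (φ.relabel (Sum.elim (fun _ => 0) Fin.succ)) y v
  refine ⟨w, fun x => (hw x).trans (and_congr_right fun _ => ?_)⟩
  refine Iff.trans ?_ (hφ fun _ => x)
  simp only [Holds, Language.Formula.realize_relabel]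
  refine iff_of_eq (congrArg _ ?_)
  funext c
  rcases c with a | a <;> simp

theorem coll (Q : M → M → Prop)
    [hQ : Dfn E R P Set.univ (fun v : Fin 2 → M => Q (v 0) (v 1))] (v : M)
    (hv : ∀ x, E x v → ∃ y, Q x y) : ∃ w, ∀ x, E x v → ∃ y, E y w ∧ Q x y := by
  obtain ⟨n, φ, z, hφ⟩ := hQ.exists_parameters
  have key : ∀ x y, Holds E R P (φ.relabel (Sum.elim (Fin.castLE (by omega))
      fun i : Fin n => i.succ.succ)) (Fin.cons x (Fin.cons y z) : Fin (n + 2) → M) ↔ Q x y := by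
    intro x y
    refine Iff.trans ?_ (hφ ![x, y])
    simp only [Holds, Language.Formula.realize_relabel]
    refine iff_of_eq (congrArg _ ?_)
    funext c
    rcases c with a | a
    · fin_cases a <;> rfl
    · simp
  obtain ⟨w, hw⟩ := h.collection n _ z v fun x hx => (hv x hx).imp fun y hy => (key x y).2 hy
  exact ⟨w, fun x hx => (hw x hx).imp fun y hy => ⟨hy.1, (key x y).1 hy.2⟩⟩

end ModelsZF

end SetTheory

/-! ### Pairs, successors and ordinals -/

section Basic

variable {M : Type*} {E : M → M → Prop}

/-- `z` is empty. -/
def IsEmptySet (E : M → M → Prop) (z : M) : Prop := ∀ x, ¬ E x z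

/-- `y = x ∪ {x}`. -/
def IsSucc (E : M → M → Prop) (x y : M) : Prop := ∀ u, E u y ↔ E u x ∨ u = x

namespace BasicAxioms

variable (h : BasicAxioms E)
include h

theorem exists_singleton (a : M) : ∃ c, ∀ x, E x c ↔ x = a := by
  obtain ⟨c, hc⟩ := h.pairing a a
  exact ⟨c, by simpa using hc⟩

theorem exists_union (a b : M) : ∃ c, ∀ x, E x c ↔ E x a ∨ E x b := by
  obtain ⟨d, hd⟩ := h.pairing a b
  obtain ⟨c, hc⟩ := h.union d
  exact ⟨c, fun x => by simp [hc, hd]⟩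

theorem exists_insert (a b : M) : ∃ c, ∀ x, E x c ↔ E x a ∨ x = b := by
  obtain ⟨d, hd⟩ := h.exists_singleton b
  obtain ⟨c, hc⟩ := h.exists_union a d
  exact ⟨c, fun x => by simp [hc, hd]⟩

theorem asymm {a b : M} (hab : E a b) : ¬ E b a := by
  intro hba
  obtain ⟨c, hc⟩ := h.pairing a b
  obtain ⟨x, hx, hx'⟩ := h.foundation c ⟨a, (hc a).2 (.inl rfl)⟩
  rcases (hc x).1 hx with rfl | rfl
  · exact hx' b hba ((hc b).2 (.inr rfl))
  · exact hx' a hab ((hc a).2 (.inl rfl))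

theorem irrefl (a : M) : ¬ E a a := fun ha => h.asymm ha ha

theorem exists_isPair (x y : M) : ∃ p, IsPair E x y p := by
  obtain ⟨a, ha⟩ := h.exists_singleton x
  obtain ⟨b, hb⟩ := h.pairing x y
  obtain ⟨p, hp⟩ := h.pairing a b
  refine ⟨p, fun z => (hp z).trans (or_congr ?_ ?_)⟩
  · exact ⟨fun e => e ▸ ha, fun hz => h.extensionality _ _ fun u => by rw [hz, ha]⟩
  · exact ⟨fun e => e ▸ hb, fun hz => h.extensionality _ _ fun u => by rw [hz, hb]⟩

theorem isPair_inj {x y x' y' p : M} (hp : IsPair E x y p) (hp' : IsPair E x' y' p) :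
    x = x' ∧ y = y' := by
  obtain ⟨a, ha⟩ := h.exists_singleton x
  obtain ⟨b, hb⟩ := h.pairing x y
  obtain ⟨b', hb'⟩ := h.pairing x' y'
  have hx : x = x' := by
    rcases (hp' a).1 ((hp a).2 (.inl ha)) with e | e
    · exact ((ha x').1 ((e x').2 rfl)).symm
    · exact ((ha x').1 ((e x').2 (.inl rfl))).symm
  subst hx
  refine ⟨rfl, ?_⟩
  have h1 := (hp' b).1 ((hp b).2 (.inr hb))
  have h2 := (hp b').1 ((hp' b').2 (.inr hb'))
  have h3 : y = x ∨ y = y' := by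
    rcases h1 with e | e
    · exact .inl ((e y).1 ((hb y).2 (.inr rfl)))
    · exact (e y).1 ((hb y).2 (.inr rfl))
  have h4 : y' = x ∨ y' = y := by
    rcases h2 with e | e
    · exact .inl ((e y').1 ((hb' y').2 (.inr rfl)))
    · exact (e y').1 ((hb' y').2 (.inr rfl))
  rcases h3 with h3 | h3
  · rcases h4 with h4 | h4
    · rw [h3, h4]
    · exact h4.symm
  · exact h3

theorem isSucc_inj {x x' y : M} (hx : IsSucc E x y) (hx' : IsSucc E x' y) : x = x' := by
  rcases (hx' x).1 ((hx x).2 (.inr rfl)) with e | e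
  · rcases (hx x').1 ((hx' x').2 (.inr rfl)) with e' | e'
    · exact absurd e' (h.asymm e)
    · exact e'.symm
  · exact e

/-- Transitive sets of ordinals are ordinals, provided that `∈` is total on them. -/
theorem isOrd_of_total {a : M} (ha : ∀ x, E x a → ∀ y, E y x → E y a)
    (ht : ∀ x, E x a → IsOrd E x) (hl : ∀ x y, E x a → E y a → E x y ∨ x = y ∨ E y x) :
    IsOrd E a where
  transitive := ha
  irrefl x _ := h.irrefl x
  trans x y z _ _ hz hxy hyz := (ht z hz).transitive y hyz x hxy
  total := hl
  least s hs hne := by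
    obtain ⟨x, hx, hx'⟩ := h.foundation s hne
    refine ⟨x, hx, fun y hy => ?_⟩
    rcases hl x y (hs x hx) (hs y hy) with e | e | e
    · exact .inr e
    · exact .inl e.symm
    · exact absurd hy (hx' y e)

theorem isOrd_of_mem {a x : M} (ha : IsOrd E a) (hx : E x a) : IsOrd E x where
  transitive y hy z hz := ha.trans z y x (ha.transitive y (ha.transitive x hx y hy) z hz)
    (ha.transitive x hx y hy) hx hz hy
  irrefl y _ := h.irrefl y
  trans u v w hu hv hw := ha.trans u v w (ha.transitive x hx u hu) (ha.transitive x hx v hv)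
    (ha.transitive x hx w hw)
  total u v hu hv := ha.total u v (ha.transitive x hx u hu) (ha.transitive x hx v hv)
  least s hs := ha.least s fun u hu => ha.transitive x hx u (hs u hu)

end BasicAxioms

end Basic

/-! ### Definability of set-theoretic notions -/

section SetTheory

variable {M : Type*} {B U : Type} {E : M → M → Prop} {R : B → M → M → Prop} {P : U → Set M}
  {A : Set M} {α : Type}

namespace Dfn

theorem subst₃ {Q : M → M → M → Prop}
    (hQ : Dfn E R P A (fun v : Fin 3 → M => Q (v 0) (v 1) (v 2)))
    (f g k : (α → M) → M) [hf : Tm A f] [hg : Tm A g] [hk : Tm A k] :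
    Dfn E R P A (fun v => Q (f v) (g v) (k v)) :=
  hQ.subst (fun i => if i = 0 then f else if i = 1 then g else k)
    (by intro i; split; · assumption
        split <;> assumption)

instance isEmptySet (f : (α → M) → M) [Tm A f] : Dfn E R P A (fun v => IsEmptySet E (f v)) :=
  subst₁ (by unfold IsEmptySet; infer_instance) f

instance isSucc (f g : (α → M) → M) [Tm A f] [Tm A g] :
    Dfn E R P A (fun v => IsSucc E (f v) (g v)) :=
  subst₂ (by unfold IsSucc; infer_instance) f g

instance isPair (f g k : (α → M) → M) [Tm A f] [Tm A g] [Tm A k] :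
    Dfn E R P A (fun v => IsPair E (f v) (g v) (k v)) :=
  subst₃ (by unfold IsPair; infer_instance) f g k

instance setRel (f g k : (α → M) → M) [Tm A f] [Tm A g] [Tm A k] :
    Dfn E R P A (fun v => SetRel E (f v) (g v) (k v)) :=
  subst₃ (Q := SetRel E)
    (inferInstanceAs (Dfn E R P A fun v : Fin 3 → M => ∃ p, E p (v 0) ∧ IsPair E (v 1) (v 2) p))
    f g k

theorem isOrd_iff (a : M) : IsOrd E a ↔ (∀ x, E x a → ∀ y, E y x → E y a) ∧
    (∀ x, E x a → ¬ E x x) ∧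
    (∀ x y z, E x a → E y a → E z a → E x y → E y z → E x z) ∧
    (∀ x y, E x a → E y a → E x y ∨ x = y ∨ E y x) ∧
    (∀ s, (∀ x, E x s → E x a) → (∃ x, E x s) → ∃ x, E x s ∧ ∀ y, E y s → y = x ∨ E x y) :=
  ⟨fun ⟨a, b, c, d, e⟩ => ⟨a, b, c, d, e⟩, fun ⟨a, b, c, d, e⟩ => ⟨a, b, c, d, e⟩⟩

instance isOrd (f : (α → M) → M) [Tm A f] : Dfn E R P A (fun v => IsOrd E (f v)) :=
  subst₁ (by simp only [isOrd_iff]; infer_instance) f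

theorem hasRank {r : M → M → Prop} (hr : Dfn E R P A (fun v : Fin 2 → M => r (v 0) (v 1)))
    (f g : (α → M) → M) [Tm A f] [Tm A g] : Dfn E R P A (fun v => HasRank E r (f v) (g v)) := by
  have : ∀ {β : Type} (f g : (β → M) → M) [Tm A f] [Tm A g],
    Dfn E R P A (fun v => r (f v) (g v)) := fun f g => subst₂ hr f g
  exact subst₂ (Q := HasRank E r) (by unfold HasRank; infer_instance) f g

end Dfn
end SetTheory
end ZFIndis
namespace ZFIndis

/-! ### Induction, transitive closure and rank, without a recursion theorem -/

section Recursion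

variable {M : Type*} {B U : Type} {E : M → M → Prop} {R : B → M → M → Prop} {P : U → Set M}

/-- Some set `f` of pairs containing `⟨n, y⟩` witnesses that `y` is reached from `x` in `n` steps
down the membership relation. -/
def Reach (E : M → M → Prop) (x n y : M) : Prop :=
  ∃ f, SetRel E f n y ∧ ∀ m v, SetRel E f m v →
    (IsEmptySet E m ∧ v = x) ∨ ∃ k z, IsSucc E k m ∧ SetRel E f k z ∧ E v z

/-- Some set `f` of pairs containing `⟨x, d⟩` witnesses that `x` has rank at most `d`. -/
def Ranked (E : M → M → Prop) (x d : M) : Prop :=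
  ∃ f, SetRel E f x d ∧ ∀ y a, SetRel E f y a → ∀ z, E z y → ∃ b, E b a ∧ SetRel E f z b

instance Dfn.reach {A : Set M} {α : Type} (f g k : (α → M) → M) [Tm A f] [Tm A g] [Tm A k] :
    Dfn E R P A (fun v => Reach E (f v) (g v) (k v)) :=
  subst₃ (by unfold Reach; infer_instance) f g k

instance Dfn.ranked {A : Set M} {α : Type} (f g : (α → M) → M) [Tm A f] [Tm A g] :
    Dfn E R P A (fun v => Ranked E (f v) (g v)) :=
  subst₂ (by unfold Ranked; infer_instance) f g

namespace BasicAxioms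

variable (h : BasicAxioms E)
include h

theorem setRel_insert (f x y : M) :
    ∃ g, ∀ u v, SetRel E g u v ↔ SetRel E f u v ∨ (u = x ∧ v = y) := by
  obtain ⟨p, hp⟩ := h.exists_isPair x y
  obtain ⟨g, hg⟩ := h.exists_insert f p
  refine ⟨g, fun u v => ⟨?_, ?_⟩⟩
  · rintro ⟨q, hq, huv⟩
    rcases (hg q).1 hq with e | rfl
    · exact .inl ⟨q, e, huv⟩
    · exact .inr (h.isPair_inj huv hp)
  · rintro (⟨q, hq, huv⟩ | ⟨rfl, rfl⟩)
    · exact ⟨q, (hg q).2 (.inl hq), huv⟩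
    · exact ⟨p, (hg p).2 (.inr rfl), hp⟩

omit h in
theorem reach_elim {x n y : M} (hr : Reach E x n y) :
    (IsEmptySet E n ∧ y = x) ∨ ∃ k z, IsSucc E k n ∧ Reach E x k z ∧ E y z := by
  obtain ⟨f, hf, hf'⟩ := hr
  exact (hf' n y hf).imp_right fun ⟨k, z, hk, hz, hyz⟩ => ⟨k, z, hk, ⟨f, hz, hf'⟩, hyz⟩

theorem reach_zero (x : M) {n : M} (hn : IsEmptySet E n) : Reach E x n x := by
  obtain ⟨f, hf⟩ := h.setRel_insert n n x
  have hf' : ∀ u v, SetRel E f u v ↔ u = n ∧ v = x := fun u v =>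
    (hf u v).trans (or_iff_right fun ⟨p, hp, _⟩ => hn p hp)
  exact ⟨f, (hf' _ _).2 ⟨rfl, rfl⟩, fun m v hm => by
    obtain ⟨rfl, rfl⟩ := (hf' _ _).1 hm
    exact .inl ⟨hn, rfl⟩⟩

theorem reach_succ {x k n z y : M} (hr : Reach E x k z) (hk : IsSucc E k n) (hy : E y z) :
    Reach E x n y := by
  obtain ⟨f, hf, hf'⟩ := hr
  obtain ⟨g, hg⟩ := h.setRel_insert f n y
  refine ⟨g, (hg _ _).2 (.inr ⟨rfl, rfl⟩), fun m v hm => ?_⟩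
  rcases (hg _ _).1 hm with hm | ⟨rfl, rfl⟩
  · exact (hf' m v hm).imp_right fun ⟨k', z', h1, h2, h3⟩ => ⟨k', z', h1, (hg _ _).2 (.inl h2), h3⟩
  · exact .inr ⟨k, z, hk, (hg _ _).2 (.inl hf), hy⟩

omit h in
theorem ranked_elim {x d : M} (hr : Ranked E x d) {z : M} (hz : E z x) :
    ∃ b, E b d ∧ Ranked E z b := by
  obtain ⟨f, hf, hf'⟩ := hr
  obtain ⟨b, hb, hzb⟩ := hf' x d hf z hz
  exact ⟨b, hb, f, hzb, hf'⟩

end BasicAxioms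

namespace ModelsZF

variable (h : ModelsZF E R P)
include h

/-- The set of natural numbers satisfies induction for definable properties. -/
theorem exists_omega : ∃ N, (∃ z, E z N ∧ IsEmptySet E z) ∧
    (∀ n, E n N → ∃ m, E m N ∧ IsSucc E n m) ∧
    ∀ Q : M → Prop, Dfn E R P Set.univ (fun v : Fin 1 → M => Q (v 0)) →
      (∀ z, IsEmptySet E z → Q z) → (∀ n m, Q n → IsSucc E n m → Q m) → ∀ n, E n N → Q n := by
  obtain ⟨w, ⟨z, hz, hz'⟩, hw⟩ := h.basic.infinity
  -- `N` is the intersection of all inductive sets; a definable `Q` closed under successor cuts out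
  -- another inductive set, which must contain `N`.
  obtain ⟨N, hN⟩ := h.sep (fun n => ∀ w, (∃ z, E z w ∧ IsEmptySet E z) →
    (∀ x, E x w → ∃ y, E y w ∧ IsSucc E x y) → E n w) w
  have succ_unique : ∀ {x y y'}, IsSucc E x y → IsSucc E x y' → y = y' := fun hy hy' =>
    h.basic.extensionality _ _ fun u => (hy u).trans (hy' u).symm
  have empty_unique : ∀ {x y}, IsEmptySet E x → IsEmptySet E y → x = y := fun hx hy =>
    h.basic.extensionality _ _ fun u => iff_of_false (hx u) (hy u)
  have h0 : ∃ z, E z N ∧ IsEmptySet E z :=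
    ⟨z, (hN z).2 ⟨hz, fun w' ⟨z', h1, h2⟩ _ => empty_unique h2 hz' ▸ h1⟩, hz'⟩
  have h1 : ∀ n, E n N → ∃ m, E m N ∧ IsSucc E n m := by
    intro n hn
    obtain ⟨hnw, hn⟩ := (hN n).1 hn
    obtain ⟨m, hm, hm'⟩ := hw n hnw
    refine ⟨m, (hN m).2 ⟨hm, fun w' hw0 hws => ?_⟩, hm'⟩
    obtain ⟨m', h1, h2⟩ := hws n (hn w' hw0 hws)
    exact succ_unique h2 hm' ▸ h1
  refine ⟨N, h0, h1, fun Q hQ hQ0 hQs n hn => ?_⟩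
  obtain ⟨w', hw'⟩ := h.sep Q N
  refine ((hw' n).1 (((hN n).1 hn).2 w' ?_ ?_)).2
  · exact h0.imp fun z hz => ⟨(hw' z).2 ⟨hz.1, hQ0 z hz.2⟩, hz.2⟩
  · intro x hx
    obtain ⟨hx, hQx⟩ := (hw' x).1 hx
    exact (h1 x hx).imp fun y hy => ⟨(hw' y).2 ⟨hy.1, hQs x y hQx hy.2⟩, hy.2⟩

/-- By induction on `n`, the points reached from `x` in `n` steps are bounded by a set. Collection
joins these bounds over all `n`, and separation extracts the transitive closure. -/
theorem exists_transitive (x : M) : ∃ T, E x T ∧ ∀ y, E y T → ∀ z, E z y → E z T := by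
  obtain ⟨N, ⟨o, hoN, ho⟩, hs, hind⟩ := h.exists_omega
  have hb : ∀ n, E n N → ∃ S, ∀ y, Reach E x n y → E y S := by
    refine hind _ inferInstance ?_ ?_
    · intro z hz
      obtain ⟨S, hS⟩ := h.basic.exists_singleton x
      refine ⟨S, fun y hy => (hS y).2 ?_⟩
      rcases BasicAxioms.reach_elim hy with hy | ⟨k, _, hk, _⟩
      · exact hy.2
      · exact absurd ((hk k).2 (.inr rfl)) (hz k)
    · rintro n m ⟨S, hS⟩ hnm
      obtain ⟨S', hS'⟩ := h.basic.union S
      refine ⟨S', fun y hy => (hS' y).2 ?_⟩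
      rcases BasicAxioms.reach_elim hy with hy | ⟨k, z, hk, hz, hyz⟩
      · exact absurd ((hnm n).2 (.inr rfl)) (hy.1 n)
      · obtain rfl := h.basic.isSucc_inj hk hnm
        exact ⟨z, hS z hz, hyz⟩
  obtain ⟨W, hW⟩ := h.coll (fun n S => ∀ y, Reach E x n y → E y S) N hb
  obtain ⟨V, hV⟩ := h.basic.union W
  obtain ⟨T, hT⟩ := h.sep (fun y => ∃ n, E n N ∧ Reach E x n y) V
  have hT' : ∀ {n y}, E n N → Reach E x n y → E y T := by
    intro n y hn hy
    obtain ⟨S, hS, hS'⟩ := hW n hn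
    exact (hT y).2 ⟨(hV y).2 ⟨S, hS, hS' y hy⟩, n, hn, hy⟩
  refine ⟨T, hT' hoN (h.basic.reach_zero x ho), fun y hy z hz => ?_⟩
  obtain ⟨-, n, hn, hr⟩ := (hT y).1 hy
  obtain ⟨m, hm, hnm⟩ := hs n hn
  exact hT' hm (h.basic.reach_succ hr hnm hz)

/-- The scheme of foundation. -/
theorem exists_minimal (Q : M → Prop) [Dfn E R P Set.univ (fun v : Fin 1 → M => Q (v 0))]
    (hQ : ∃ x, Q x) : ∃ x, Q x ∧ ∀ y, E y x → ¬ Q y := by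
  obtain ⟨x, hx⟩ := hQ
  obtain ⟨T, hxT, hT⟩ := h.exists_transitive x
  obtain ⟨S, hS⟩ := h.sep Q T
  obtain ⟨y, hy, hy'⟩ := h.basic.foundation S ⟨x, (hS x).2 ⟨hxT, hx⟩⟩
  obtain ⟨hyT, hyQ⟩ := (hS y).1 hy
  exact ⟨y, hyQ, fun z hz hzQ => hy' z hz ((hS z).2 ⟨hT y hyT z hz, hzQ⟩)⟩

theorem mem_induction (Q : M → Prop) [Dfn E R P Set.univ (fun v : Fin 1 → M => Q (v 0))]
    (step : ∀ x, (∀ y, E y x → Q y) → Q x) (x : M) : Q x := by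
  by_contra hx
  obtain ⟨y, hy, hy'⟩ := h.exists_minimal (fun x => ¬ Q x) ⟨x, hx⟩
  exact hy (step y fun z hz => not_not.1 (hy' z hz))

/-- If `c ≠ a`, the least element of `a \ c` has the same members as `c`. -/
theorem isOrd_mem_or_eq_of_subset {a c : M} (ha : IsOrd E a) (hc : ∀ x, E x c → E x a)
    (hc' : ∀ x, E x c → ∀ y, E y x → E y c) : E c a ∨ c = a := by
  by_contra! hne
  obtain ⟨d, hd⟩ := h.sep (fun x => ¬ E x c) a
  have : ∃ x, E x d := by
    by_contra! hd'
    refine hne.2 (h.basic.extensionality _ _ fun x => ⟨hc x, fun hx => ?_⟩)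
    by_contra hxc
    exact hd' x ((hd x).2 ⟨hx, hxc⟩)
  obtain ⟨x, hx, hx'⟩ := ha.least d (fun x hx => ((hd x).1 hx).1) this
  obtain ⟨hxa, hxc⟩ := (hd x).1 hx
  refine hne.1 ?_
  rwa [h.basic.extensionality c x fun y => ⟨fun hy => ?_, fun hy => ?_⟩]
  · rcases ha.total y x (hc y hy) hxa with e | rfl | e
    · exact e
    · exact absurd hy hxc
    · exact absurd (hc' y hy x e) hxc
  · by_contra hyc
    rcases hx' y ((hd y).2 ⟨ha.transitive x hxa y hy, hyc⟩) with rfl | e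
    · exact h.basic.irrefl _ hy
    · exact h.basic.asymm e hy

theorem isOrd_total {a b : M} (ha : IsOrd E a) (hb : IsOrd E b) : E a b ∨ a = b ∨ E b a := by
  obtain ⟨c, hc⟩ := h.sep (fun x => E x b) a
  have hc' : ∀ x, E x c → ∀ y, E y x → E y c := fun x hx y hy =>
    (hc y).2 ⟨ha.transitive x ((hc x).1 hx).1 y hy, hb.transitive x ((hc x).1 hx).2 y hy⟩
  rcases h.isOrd_mem_or_eq_of_subset ha (fun x hx => ((hc x).1 hx).1) hc' with h1 | rfl
  · rcases h.isOrd_mem_or_eq_of_subset hb (fun x hx => ((hc x).1 hx).2) hc' with h2 | rfl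
    · exact absurd ((hc c).2 ⟨h1, h2⟩) (h.basic.irrefl c)
    · exact .inr (.inr h1)
  · rcases h.isOrd_mem_or_eq_of_subset hb (fun x hx => ((hc x).1 hx).2) hc' with h2 | rfl
    · exact .inl h2
    · exact .inr (.inl rfl)

/-- The ordinals in a set are bounded by an ordinal. -/
theorem exists_isOrd_gt (W : M) : ∃ d, IsOrd E d ∧ ∀ b, E b W → IsOrd E b → E b d := by
  obtain ⟨s, hs⟩ := h.sep (fun x => IsOrd E x) W
  obtain ⟨u, hu⟩ := h.basic.union s
  -- The supremum `u` may itself belong to `W`, so its successor is the strict bound.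
  obtain ⟨d, hd⟩ := h.basic.exists_insert u u
  have ht : ∀ x, E x u → IsOrd E x := fun x hx => by
    obtain ⟨y, hy, hxy⟩ := (hu x).1 hx
    exact h.basic.isOrd_of_mem ((hs y).1 hy).2 hxy
  have hu' : IsOrd E u := by
    refine h.basic.isOrd_of_total (fun x hx y hy => ?_) ht
      fun x y hx hy => h.isOrd_total (ht x hx) (ht y hy)
    obtain ⟨z, hz, hxz⟩ := (hu x).1 hx
    exact (hu y).2 ⟨z, hz, ((hs z).1 hz).2.transitive x hxz y hy⟩
  have hd' : ∀ x, E x d → IsOrd E x := fun x hx => by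
    rcases (hd x).1 hx with hx | rfl
    exacts [ht x hx, hu']
  have hd'' : IsOrd E d := by
    refine h.basic.isOrd_of_total (fun x hx y hy => (hd y).2 (.inl ?_)) hd'
      fun x y hx hy => h.isOrd_total (hd' x hx) (hd' y hy)
    rcases (hd x).1 hx with hx | rfl
    exacts [hu'.transitive x hx y hy, hy]
  refine ⟨d, hd'', fun b hb hbo => ?_⟩
  have hbs := (hs b).2 ⟨hb, hbo⟩
  have hub : ¬ E u b := fun hub => h.basic.irrefl u ((hu u).2 ⟨b, hbs, hub⟩)
  rcases h.isOrd_total hbo hu' with e | e | e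
  · exact (hd b).2 (.inl e)
  · exact (hd b).2 (.inr e)
  · exact absurd e hub

/-- This replaces the cumulative hierarchy. Members of `x` are ranked by elements of `d`, so by
induction they lie in one set, and `x` lies in its power set. -/
theorem exists_bound_ranked (d : M) : ∃ V, ∀ x, Ranked E x d → E x V := by
  refine h.mem_induction (fun d => ∃ V, ∀ x, Ranked E x d → E x V) (fun d hd => ?_) d
  obtain ⟨W, hW⟩ := h.coll (fun b V => ∀ x, Ranked E x b → E x V) d hd
  obtain ⟨u, hu⟩ := h.basic.union W
  obtain ⟨V, hV⟩ := h.basic.powerset u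
  refine ⟨V, fun x hx => (hV x).2 fun z hz => ?_⟩
  obtain ⟨b, hb, hzb⟩ := BasicAxioms.ranked_elim hx hz
  obtain ⟨V', hV', hV''⟩ := hW b hb
  exact (hu z).2 ⟨V', hV', hV'' z hzb⟩

/-- A union of witnesses is again closed in the required sense, since witnesses need not be
functions; adding `⟨x, d⟩` to it gives a witness for `x`. -/
theorem ranked_intro {x d : M} (hx : ∀ z, E z x → ∃ b, E b d ∧ Ranked E z b) : Ranked E x d := by
  obtain ⟨W, hW⟩ := h.coll (fun z f => (∃ b, E b d ∧ SetRel E f z b) ∧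
      ∀ y a, SetRel E f y a → ∀ z, E z y → ∃ b, E b a ∧ SetRel E f z b) x (by
    intro z hz
    obtain ⟨b, hb, f, hf, hf'⟩ := hx z hz
    exact ⟨f, ⟨b, hb, hf⟩, hf'⟩)
  -- Collection may have put sets into `W` that are not witnesses; they are discarded before taking
  -- the union.
  obtain ⟨W', hW'⟩ := h.sep (fun f =>
    ∀ y a, SetRel E f y a → ∀ z, E z y → ∃ b, E b a ∧ SetRel E f z b) W
  obtain ⟨u, hu⟩ := h.basic.union W'
  obtain ⟨g, hg⟩ := h.basic.setRel_insert u x d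
  have hu' : ∀ y a, SetRel E u y a ↔ ∃ f, E f W' ∧ SetRel E f y a := by
    intro y a
    constructor
    · rintro ⟨p, hp, hya⟩
      obtain ⟨f, hf, hpf⟩ := (hu p).1 hp
      exact ⟨f, hf, p, hpf, hya⟩
    · rintro ⟨f, hf, p, hpf, hya⟩
      exact ⟨p, (hu p).2 ⟨f, hf, hpf⟩, hya⟩
  refine ⟨g, (hg _ _).2 (.inr ⟨rfl, rfl⟩), fun y a hya z hz => ?_⟩
  rcases (hg _ _).1 hya with hya | ⟨rfl, rfl⟩
  · obtain ⟨f, hf, hya⟩ := (hu' _ _).1 hya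
    obtain ⟨b, hb, hzb⟩ := ((hW' f).1 hf).2 y a hya z hz
    exact ⟨b, hb, (hg _ _).2 (.inl ((hu' _ _).2 ⟨f, hf, hzb⟩))⟩
  · obtain ⟨f, hf, ⟨b, hb, hzb⟩, hf'⟩ := hW z hz
    exact ⟨b, hb, (hg _ _).2 (.inl ((hu' _ _).2 ⟨f, (hW' f).2 ⟨hf, hf'⟩, hzb⟩))⟩

theorem exists_ranked (x : M) : ∃ d, IsOrd E d ∧ Ranked E x d := by
  refine h.mem_induction (fun x => ∃ d, IsOrd E d ∧ Ranked E x d) (fun x hx => ?_) x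
  obtain ⟨W, hW⟩ := h.coll (fun z b => IsOrd E b ∧ Ranked E z b) x hx
  obtain ⟨d, hd, hd'⟩ := h.exists_isOrd_gt W
  refine ⟨d, hd, h.ranked_intro fun z hz => ?_⟩
  obtain ⟨b, hb, hbo, hzb⟩ := hW z hz
  exact ⟨b, hd' b hb hbo, hzb⟩

end ModelsZF
end Recursion
end ZFIndis
namespace ZFIndis

/-! ### Coding of parameters, and indiscernibility over small parameters -/

section Indiscernibles

variable {M : Type*} {B U : Type} {E : M → M → Prop} {R : B → M → M → Prop} {P : U → Set M}

theorem BasicAxioms.exists_dfn_singleton (h : BasicAxioms E) (A : Finset M) :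
    ∃ p, ∀ a ∈ A, Dfn E R P {p} (fun v : Fin 1 → M => v 0 = a) := by
  classical
  induction A using Finset.induction with
  -- Any element will do; infinity only serves to show that `M` is nonempty.
  | empty => exact h.infinity.imp fun p _ => by simp
  | insert a A _ ih =>
    obtain ⟨q, hq⟩ := ih
    obtain ⟨p, hp⟩ := h.exists_isPair a q
    have ha : Dfn E R P {p} (fun v : Fin 1 → M => v 0 = a) :=
      .congr (Q := fun v => ∃ u, IsPair E (v 0) u p) (fun v =>
        ⟨fun ⟨u, hu⟩ => (h.isPair_inj hu hp).1, fun e => ⟨q, e ▸ hp⟩⟩) inferInstance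
    have hqp : Dfn E R P {p} (fun v : Fin 1 → M => v 0 = q) :=
      .congr (Q := fun v => ∃ u, IsPair E u (v 0) p) (fun v =>
        ⟨fun ⟨u, hu⟩ => (h.isPair_inj hu hp).2, fun e => ⟨a, e ▸ hp⟩⟩) inferInstance
    refine ⟨p, fun b hb => ?_⟩
    rcases Finset.mem_insert.1 hb with rfl | hb
    · exact ha
    · exact Dfn.trans (A := {q}) (by simpa using hqp) (by simpa using hq b hb)

/-- A definable relation is definable from a single parameter, since parameters can be coded by
ordered pairs. -/
theorem BasicAxioms.exists_single_parameter (h : BasicAxioms E) {Q : M → M → Prop}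
    (hQ : Dfn E R P Set.univ (fun v : Fin 2 → M => Q (v 0) (v 1))) :
    ∃ (p : M) (S : M → M → M → Prop), Dfn E R P ∅ (fun v : Fin 3 → M => S (v 0) (v 1) (v 2)) ∧
      ∀ x y, Q x y ↔ S p x y := by
  let := str E R P
  obtain ⟨A, -, hA⟩ := Set.definable_iff_finitely_definable.1 hQ.out
  obtain ⟨p, hp⟩ := h.exists_dfn_singleton (R := R) (P := P) A
  obtain ⟨φ, hφ⟩ := Set.definable_iff_exists_formula_sum.1 (Dfn.trans hp ⟨hA⟩).out
  let ψ : (lang B U).Formula (Fin 3) := φ.relabel (Sum.elim (fun _ => 0) Fin.succ)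
  refine ⟨p, fun q x y => Holds E R P ψ ![q, x, y], ?_, fun x y => ?_⟩
  · refine .congr (fun v => iff_of_eq (congrArg _ ?_)) (Dfn.ofFormula ψ)
    funext c
    fin_cases c <;> rfl
  · refine (Set.ext_iff.1 hφ ![x, y]).trans ?_
    refine Iff.trans ?_ Language.Formula.realize_relabel.symm
    rw [Set.mem_ofPred_eq]
    refine iff_of_eq (congrArg _ ?_)
    funext c
    rcases c with a | a
    · exact a.2
    · rfl

namespace ModelsZF

variable (h : ModelsZF E R P) {J : Set M} (hJ : Cofinal E J)
include h hJ

theorem exists_mem_above {i j : M} (hi : IsOrd E i) (hj : IsOrd E j) :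
    ∃ b ∈ J, E i b ∧ E j b := by
  have key : ∀ {i j}, IsOrd E j → (E i j ∨ i = j) → ∃ b ∈ J, E i b ∧ E j b := by
    intro i j hj hij
    obtain ⟨b, hb, hjb⟩ := hJ.2 j hj
    refine ⟨b, hb, ?_, hjb⟩
    rcases hij with hij | rfl
    exacts [(hJ.1 b hb).transitive j hjb i hij, hjb]
  rcases h.isOrd_total hi hj with e | e | e
  · exact key hj (.inl e)
  · exact key hj (.inr e)
  · obtain ⟨b, hb, h1, h2⟩ := key hi (.inl e)
    exact ⟨b, hb, h2, h1⟩

/-- Cofinal indiscernibles above `i` are indiscernible with respect to parameters that have rank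
below `i`. -/
theorem indiscernible_parameters {U' : Type} {P' : U' → Set M} (hi : Indiscernible E R P' J)
    (hJd : Dfn E R P Set.univ (fun v : Fin 1 → M => v 0 ∈ J)) {S : M → M → Prop}
    (hS : Dfn E R P Set.univ (fun v : Fin 2 → M => S (v 0) (v 1)))
    (hS' : Dfn E R P' ∅ (fun v : Fin 2 → M => S (v 0) (v 1))) {i b c q : M} (hiJ : i ∈ J)
    (hb : b ∈ J) (hc : c ∈ J) (hib : E i b) (hic : E i c) (hq : ∃ d, E d i ∧ Ranked E q d) :
    S q b ↔ S q c := by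
  have instS : ∀ {α : Type} (f g : (α → M) → M) [Tm Set.univ f] [Tm Set.univ g],
    Dfn E R P Set.univ (fun v => S (f v) (g v)) := fun f g => hS.subst₂ f g
  have instS' : ∀ {α : Type} (f g : (α → M) → M) [Tm ∅ f] [Tm ∅ g],
    Dfn E R P' ∅ (fun v => S (f v) (g v)) := fun f g => hS'.subst₂ f g
  have instJ : ∀ {α : Type} (f : (α → M) → M) [Tm Set.univ f],
    Dfn E R P Set.univ (fun v => f v ∈ J) := fun f => hJd.subst₁ (Q := fun x => x ∈ J) f
  -- Quantifying over `q` inside `G` removes the parameter, so that parameter-free indiscernibility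
  -- applies to `G`.
  let G : M → M → M → Prop := fun i b c => ∀ q, (∃ d, E d i ∧ Ranked E q d) → (S q b ↔ S q c)
  have hG : Dfn E R P' ∅ (fun v : Fin 3 → M => G (v 0) (v 1) (v 2)) :=
    inferInstanceAs (Dfn E R P' ∅ (fun v : Fin 3 → M => ∀ q, (∃ d, E d (v 0) ∧ Ranked E q d) →
      (S q (v 1) ↔ S q (v 2))))
  obtain ⟨φ, hφ⟩ := hG.exists_formula
  have hGiff : ∀ {i b c i' b' c'}, i ∈ J → b ∈ J → c ∈ J → E i b → E b c → i' ∈ J → b' ∈ J →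
      c' ∈ J → E i' b' → E b' c' → G i b c → G i' b' c' := by
    intro i b c i' b' c' hi1 hb1 hc1 hib hbc hi2 hb2 hc2 hib' hbc' hG
    have key : ∀ {i b c : M}, c ∈ J → E i b → E b c →
        ∀ m n : Fin 3, m < n → E (![i, b, c] m) (![i, b, c] n) := by
      intro i b c hcJ hib hbc m n hmn
      have hic := (hJ.1 c hcJ).transitive b hbc i hib
      fin_cases m <;> fin_cases n <;> first | assumption | exact absurd hmn (by decide)
    exact (hφ ![i', b', c']).1 ((hi 3 φ ![i, b, c] ![i', b', c']
      (by intro m; fin_cases m <;> assumption) (by intro m; fin_cases m <;> assumption)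
      (key hc1 hib hbc) (key hc2 hib' hbc')).1 ((hφ ![i, b, c]).2 hG))
  have main : ∃ b ∈ J, ∃ c ∈ J, E i b ∧ E b c ∧ G i b c := by
    by_contra! hno
    obtain ⟨V, hV⟩ := h.exists_bound_ranked i
    have hsub : ∀ q, (∃ d, E d i ∧ Ranked E q d) → E q V := fun q ⟨d, hd, hqd⟩ =>
      hV q (h.ranked_intro fun z hz => by
        obtain ⟨b, hb, hzb⟩ := BasicAxioms.ranked_elim hqd hz
        exact ⟨b, (hJ.1 i hiJ).transitive d hd b hb, hzb⟩)
    obtain ⟨K, hK⟩ := h.basic.powerset V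
    -- To each possible trace `s` is attached an ordinal beyond which no element of `J` has trace
    -- `s`: the unique owner of `s` if there is one, and `i` otherwise. An element of `J` above all
    -- these ordinals has no possible trace.
    obtain ⟨W, hW⟩ := h.coll (fun s b => IsOrd E b ∧ ∀ c, c ∈ J → E i c → E b c →
        ¬ ∀ q, E q s ↔ (∃ d, E d i ∧ Ranked E q d) ∧ S q c) K (by
      intro s _
      by_cases hs : ∃ b, b ∈ J ∧ E i b ∧ ∀ q, E q s ↔ (∃ d, E d i ∧ Ranked E q d) ∧ S q b
      · obtain ⟨b, hb, hib, hsb⟩ := hs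
        refine ⟨b, hJ.1 b hb, fun c hc hic hbc hsc => hno b hb c hc hib hbc fun q hq => ?_⟩
        have := (hsb q).symm.trans (hsc q)
        simpa only [hq, true_and] using this
      · exact ⟨i, hJ.1 i hiJ, fun c hc hic _ hsc => hs ⟨c, hc, hic, hsc⟩⟩)
    obtain ⟨d, hd, hWd⟩ := h.exists_isOrd_gt W
    obtain ⟨c, hc, hic, hdc⟩ := h.exists_mem_above hJ (hJ.1 i hiJ) hd
    obtain ⟨s, hs⟩ := h.sep (fun q => (∃ d, E d i ∧ Ranked E q d) ∧ S q c) V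
    obtain ⟨b, hb, hbo, hb'⟩ := hW s ((hK s).2 fun q hq => ((hs q).1 hq).1)
    exact hb' c hc hic ((hJ.1 c hc).transitive d hdc b (hWd b hb hbo)) fun q =>
      (hs q).trans ⟨fun hq => hq.2, fun hq => ⟨hsub q hq.1, hq⟩⟩
  obtain ⟨b₀, hb₀, c₀, hc₀, hib₀, hbc₀, hG₀⟩ := main
  rcases h.isOrd_total (hJ.1 b hb) (hJ.1 c hc) with e | rfl | e
  · exact hGiff hiJ hb₀ hc₀ hib₀ hbc₀ hiJ hb hc hib e hG₀ q hq
  · exact Iff.rfl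
  · exact (hGiff hiJ hb₀ hc₀ hib₀ hbc₀ hiJ hc hb hic e hG₀ q hq).symm

end ModelsZF
end Indiscernibles
end ZFIndis
namespace ZFIndis

/-! ### Branches through definable trees -/

section Tree

variable {M : Type*} {E r : M → M → Prop}

/-- If `f` is the isomorphism of `b` with the predecessors of `t`, take `s = f(a)` and restrict `f`
to `a`. -/
theorem ModelsZF.exists_lt_hasRank {B U : Type} {R : B → M → M → Prop} {P : U → Set M}
    (h : ModelsZF E R P) (hr : ∀ s t u, r s t → r t u → r s u) {t a b : M}
    (ht : HasRank E r t b) (ha : IsOrd E a) (hab : E a b) : ∃ s, r s t ∧ HasRank E r s a := by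
  obtain ⟨hb, f, hf1, hf2, hf3, hf4⟩ := ht
  obtain ⟨s, hs, -⟩ := hf2 a hab
  refine ⟨s, (hf1 a s hs).2, ha, ?_⟩
  obtain ⟨g, hg⟩ := h.sep (fun p => ∃ x u, E x a ∧ IsPair E x u p) f
  have hg' : ∀ x u, SetRel E g x u ↔ SetRel E f x u ∧ E x a := by
    intro x u
    constructor
    · rintro ⟨p, hp, hxu⟩
      obtain ⟨hpf, x', u', hx', hxu'⟩ := (hg p).1 hp
      obtain ⟨rfl, rfl⟩ := h.basic.isPair_inj hxu hxu'
      exact ⟨⟨p, hpf, hxu⟩, hx'⟩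
    · rintro ⟨⟨p, hp, hxu⟩, hx⟩
      exact ⟨p, (hg p).2 ⟨hp, x, u, hx, hxu⟩, hxu⟩
  refine ⟨g, fun x u hxu => ?_, fun x hx => ?_, fun u hu => ?_, fun x y u v hxu hyv => ?_⟩
  · rw [hg'] at hxu
    exact ⟨hxu.2, (hf4 x a u s hxu.1 hs).1 hxu.2⟩
  · obtain ⟨u, hu, hu'⟩ := hf2 x (hb.transitive a hab x hx)
    exact ⟨u, (hg' _ _).2 ⟨hu, hx⟩, fun v hv => hu' v ((hg' _ _).1 hv).1⟩
  · obtain ⟨x, hx, hx'⟩ := hf3 u (hr u s t hu (hf1 a s hs).2)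
    exact ⟨x, (hg' _ _).2 ⟨hx, (hf4 x a u s hx hs).2 hu⟩, fun y hy => hx' y ((hg' _ _).1 hy).1⟩
  · exact hf4 x y u v ((hg' _ _).1 hxu).1 ((hg' _ _).1 hyv).1

/-- `s` is below the `lt`-least node of rank `b`. -/
def BelowLeast (E lt : M → M → Prop) (τ : Set M) (r : M → M → Prop) (s b : M) : Prop :=
  ∃ t, (t ∈ τ ∧ HasRank E r t b) ∧ (∀ u, u ∈ τ ∧ HasRank E r u b → u = t ∨ lt t u) ∧ r s t

theorem Dfn.belowLeast {U : Type} {lt : M → M → Prop} {P : U → Set M} {A : Set M} {τ : Set M}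
    (hτ : Dfn E (fun _ : Unit => lt) P A (fun v : Fin 1 → M => v 0 ∈ τ))
    (hr : Dfn E (fun _ : Unit => lt) P A (fun v : Fin 2 → M => r (v 0) (v 1))) :
    Dfn E (fun _ : Unit => lt) P A (fun v : Fin 2 → M => BelowLeast E lt τ r (v 0) (v 1)) := by
  have : ∀ {α : Type} (f g : (α → M) → M) [Tm A f] [Tm A g],
    Dfn E (fun _ : Unit => lt) P A (fun v => r (f v) (g v)) := fun f g => subst₂ hr f g
  have : ∀ {α : Type} (f : (α → M) → M) [Tm A f],
    Dfn E (fun _ : Unit => lt) P A (fun v => f v ∈ τ) :=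
      fun f => subst₁ (Q := fun x => x ∈ τ) hτ f
  have : ∀ {α : Type} (f g : (α → M) → M) [Tm A f] [Tm A g],
    Dfn E (fun _ : Unit => lt) P A (fun v => HasRank E r (f v) (g v)) := hasRank hr
  unfold BelowLeast
  infer_instance

theorem Dfn.classRel {B U : Type} {R : B → M → M → Prop} {P : U → Set M} {A F : Set M}
    (hF : Dfn E R P A (fun v : Fin 1 → M => v 0 ∈ F)) :
    Dfn E R P A (fun v : Fin 2 → M => ClassRel E F (v 0) (v 1)) := by
  have : ∀ {α : Type} (f : (α → M) → M) [Tm A f], Dfn E R P A (fun v => f v ∈ F) :=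
    fun f => subst₁ (Q := fun x => x ∈ F) hF f
  unfold ClassRel
  infer_instance

variable {lt : M → M → Prop} {U U' : Type} {P : U → Set M} {P' : U' → Set M} {J τ : Set M}

/-- An `Ord`-tree that is definable in a structure with cofinal indiscernibles `J` has a branch
definable from `J`: the nodes that lie below the least node of rank `b` for all large `b ∈ J`. -/
theorem ModelsZF.exists_branch (h : ModelsZF E (fun _ : Unit => lt) P)
    (hlt : GlobalWellOrder E lt) (hJ : Cofinal E J)
    (hi : Indiscernible E (fun _ : Unit => lt) P' J)
    (hP' : ∀ i, Dfn E (fun _ : Unit => lt) P Set.univ (fun v : Fin 1 → M => v 0 ∈ P' i))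
    (hJd : Dfn E (fun _ : Unit => lt) P Set.univ (fun v : Fin 1 → M => v 0 ∈ J))
    (hτ : Dfn E (fun _ : Unit => lt) P' Set.univ (fun v : Fin 1 → M => v 0 ∈ τ))
    (hr : Dfn E (fun _ : Unit => lt) P' Set.univ (fun v : Fin 2 → M => r (v 0) (v 1)))
    (ht : IsOrdTree E τ r) :
    ∃ b : Set M, Dfn E (fun _ : Unit => lt) P Set.univ (fun v : Fin 1 → M => v 0 ∈ b) ∧
      IsBranch E τ r b := by
  have hbl := Dfn.belowLeast hτ hr
  obtain ⟨p, S, hS, hpS⟩ := h.basic.exists_single_parameter hbl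
  have instS' : ∀ {α : Type} (f g k : (α → M) → M) [Tm ∅ f] [Tm ∅ g] [Tm ∅ k],
    Dfn E (fun _ : Unit => lt) P' ∅ (fun v => S (f v) (g v) (k v)) :=
      fun f g k => hS.subst₃ f g k
  -- The pair `q = ⟨p, s⟩` merges the parameter of the tree and the node into the single parameter
  -- that `indiscernible_parameters` admits.
  let S₂ : M → M → Prop := fun q b => ∃ x s, IsPair E x s q ∧ S x s b
  have hS₂ : Dfn E (fun _ : Unit => lt) P' ∅ (fun v : Fin 2 → M => S₂ (v 0) (v 1)) :=
    inferInstanceAs (Dfn E (fun _ : Unit => lt) P' ∅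
      (fun v : Fin 2 → M => ∃ x s, IsPair E x s (v 0) ∧ S x s (v 1)))
  have lift : ∀ {α : Type} {Q : (α → M) → Prop}, Dfn E (fun _ : Unit => lt) P' Set.univ Q →
      Dfn E (fun _ : Unit => lt) P Set.univ Q := by
    intro α Q hQ
    obtain ⟨n, φ, y, hφ⟩ := hQ.exists_parameters
    have := Dfn.interp_formula (ι := Unit) (𝓕 := pure ()) (E := E) (R := fun _ : Unit => lt)
      (P := fun _ => P) (A := Set.univ) (R' := fun _ : Unit => lt) (P' := P')
      (fun b => .of_forall fun _ => Dfn.bin_var b) (fun u => .of_forall fun _ => hP' u) φ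
    refine .congr hφ ((Filter.eventually_pure.1 this).subst (α := α)
      (fun c v => Sum.elim v y c) ?_)
    rintro (a | a)
    exacts [Tm.var _ _, Tm.const _]
  have hS₂' := lift (hS₂.mono (Set.empty_subset _))
  have instbl : ∀ {α : Type} (f g : (α → M) → M) [Tm Set.univ f] [Tm Set.univ g],
    Dfn E (fun _ : Unit => lt) P Set.univ (fun v => BelowLeast E lt τ r (f v) (g v)) :=
      fun f g => (lift hbl).subst₂ f g
  have instJ : ∀ {α : Type} (f : (α → M) → M) [Tm Set.univ f],
    Dfn E (fun _ : Unit => lt) P Set.univ (fun v => f v ∈ J) :=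
      fun f => hJd.subst₁ (Q := fun x => x ∈ J) f
  have least_unique : ∀ {s u b}, BelowLeast E lt τ r s b → BelowLeast E lt τ r u b →
      ∃ t, r s t ∧ r u t := by
    rintro s u b ⟨t, h1, h2, h3⟩ ⟨t', h1', h2', h3'⟩
    have : t = t' := by
      rcases h2 t' h1' with e | e
      · exact e.symm
      · rcases h2' t h1 with e' | e'
        · exact e'
        · exact absurd (hlt.trans _ _ _ e e') (hlt.irrefl _)
    subst this
    exact ⟨t, h3, h3'⟩
  refine ⟨{s | ∃ i, i ∈ J ∧ ∀ b, b ∈ J → E i b → BelowLeast E lt τ r s b},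
    inferInstanceAs (Dfn E (fun _ : Unit => lt) P Set.univ (fun v : Fin 1 → M =>
      ∃ i, i ∈ J ∧ ∀ b, b ∈ J → E i b → BelowLeast E lt τ r (v 0) b)), ?_, ?_, ?_, ?_⟩
  · rintro s ⟨i, hi, hs⟩
    obtain ⟨b, hb, hib⟩ := hJ.2 i (hJ.1 i hi)
    obtain ⟨t, -, -, hst⟩ := hs b hb hib
    exact (ht.field s t hst).1
  · rintro s ⟨i, hi, hs⟩ u ⟨j, hj, hu⟩
    obtain ⟨b, hb, hib, hjb⟩ := h.exists_mem_above hJ (hJ.1 i hi) (hJ.1 j hj)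
    obtain ⟨t, hst, hut⟩ := least_unique (hs b hb hib) (hu b hb hjb)
    exact ht.linear_below s u t hst hut
  · rintro t ⟨i, hi, h'⟩ s hst
    refine ⟨i, hi, fun b hb hib => ?_⟩
    obtain ⟨u, h1, h2, h3⟩ := h' b hb hib
    exact ⟨u, h1, h2, ht.trans s t u hst h3⟩
  · intro a ha
    obtain ⟨c, hc⟩ := ht.level_isSet a ha
    -- As level `a` is a set, one `i ∈ J` lies above the ranks of the pairs `⟨p, s⟩` for all its
    -- nodes `s`, whichever of them turns out to be on the branch.
    obtain ⟨W, hW⟩ := h.coll (fun s q => IsPair E p s q) c fun s _ => h.basic.exists_isPair p s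
    obtain ⟨d, hd, hWd⟩ := h.exists_ranked W
    obtain ⟨i, hiJ, hai, hdi⟩ := h.exists_mem_above hJ ha hd
    obtain ⟨b, hb, hib⟩ := hJ.2 i (hJ.1 i hiJ)
    have hab := (hJ.1 b hb).transitive i hib a hai
    obtain ⟨l, hl⟩ := ht.level_isSet b (hJ.1 b hb)
    obtain ⟨t₀, ht₀, hr₀⟩ := ht.node_of_rank b (hJ.1 b hb)
    obtain ⟨t, htl, ht'⟩ := hlt.least l ⟨t₀, (hl t₀).2 ⟨ht₀, hr₀⟩⟩
    obtain ⟨s, hst, hsa⟩ := h.exists_lt_hasRank ht.trans ((hl t).1 htl).2 ha hab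
    have hsb : BelowLeast E lt τ r s b := ⟨t, (hl t).1 htl, fun u hu => ht' u ((hl u).2 hu), hst⟩
    refine ⟨s, ⟨i, hiJ, fun b' hb' hib' => ?_⟩, hsa⟩
    obtain ⟨q, hqW, hq⟩ := hW s ((hc s).2 ⟨(ht.field s t hst).1, hsa⟩)
    obtain ⟨e, he, hqe⟩ := BasicAxioms.ranked_elim hWd hqW
    have hS₂iff : ∀ b, S₂ q b ↔ BelowLeast E lt τ r s b := by
      intro b
      rw [hpS]
      constructor
      · rintro ⟨x, u, hxu, hS⟩
        obtain ⟨rfl, rfl⟩ := h.basic.isPair_inj hxu hq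
        exact hS
      · exact fun hS => ⟨p, s, hq, hS⟩
    rw [← hS₂iff] at hsb ⊢
    exact (h.indiscernible_parameters hJ hi hJd hS₂' hS₂ hiJ hb hb' hib hib'
      ⟨e, (hJ.1 i hiJ).transitive d hdi e he, hqe⟩).1 hsb

end Tree

/-! ### Reducts, GBC and weak compactness -/

section Main

variable {M : Type*} {E lt : M → M → Prop} {I : ℕ → Set M}

/-- A relation definable in `(M, E, lt, I₀, I₁, …)` is definable from finitely many `I_j`. -/
theorem Dfn.eventually_reduct {α : Type} {Q : (α → M) → Prop}
    (hQ : Dfn E (fun _ : Unit => lt) I Set.univ Q) :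
    ∀ᶠ k in Filter.atTop, Dfn E (fun _ : Unit => lt) (fun i : Fin k => I i) Set.univ Q := by
  obtain ⟨n, φ, y, hφ⟩ := hQ.exists_parameters
  filter_upwards [interp_formula (𝓕 := Filter.atTop) (E := E) (R := fun _ : Unit => lt)
    (P := fun (k : ℕ) (i : Fin k) => I i) (A := Set.univ) (R' := fun _ : Unit => lt) (P' := I)
    (fun b => .of_forall fun _ => bin_var b)
    (fun u => (Filter.eventually_gt_atTop u).mono fun k hk =>
      un_var (P := fun i : Fin k => I i) ⟨u, hk⟩) φ] with k hk
  refine congr hφ (hk.subst (α := α) (fun c v => Sum.elim v y c) ?_)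
  rintro (a | a)
  exacts [Tm.var _ _, Tm.const _]

theorem ModelsZFIomega.modelsZF (hM : ModelsZFIomega E lt I) :
    ModelsZF E (fun _ : Unit => lt) I where
  basic := ((hM 1 le_rfl).zf 1 le_rfl le_rfl).basic
  separation n φ y v := by
    obtain ⟨k, hk, hk1⟩ := ((Dfn.ofFormula (E := E) (R := fun _ : Unit => lt) (P := I)
      (A := Set.univ) φ).eventually_reduct.and (Filter.eventually_ge_atTop 1)).exists
    have : Dfn E (fun _ : Unit => lt) (fun i : Fin k => I i) Set.univ (fun v : Fin 1 → M =>
        Holds E (fun _ : Unit => lt) I φ (Fin.cons (v 0) y)) := by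
      refine .congr ?_ (hk.subst (α := Fin 1)
        (fun c v => (Fin.cons (v 0) y : Fin (n + 1) → M) c) ?_)
      · exact fun v => Iff.rfl
      · refine Fin.cases ?_ fun i => ?_
        exacts [Tm.var _ _, Tm.const _]
    exact ((hM k hk1).zf k hk1 le_rfl).sep
      (fun x => Holds E (fun _ : Unit => lt) I φ (Fin.cons x y)) v
  collection n φ z v hv := by
    obtain ⟨k, hk, hk1⟩ := ((Dfn.ofFormula (E := E) (R := fun _ : Unit => lt) (P := I)
      (A := Set.univ) φ).eventually_reduct.and (Filter.eventually_ge_atTop 1)).exists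
    have : Dfn E (fun _ : Unit => lt) (fun i : Fin k => I i) Set.univ (fun v : Fin 2 → M =>
        Holds E (fun _ : Unit => lt) I φ (Fin.cons (v 0) (Fin.cons (v 1) z))) := by
      refine .congr ?_ (hk.subst (α := Fin 2)
        (fun c v => (Fin.cons (v 0) (Fin.cons (v 1) z : Fin (n + 1) → M) : Fin (n + 2) → M) c) ?_)
      · exact fun v => Iff.rfl
      · refine Fin.cases ?_ (Fin.cases ?_ fun i => ?_)
        exacts [Tm.var _ _, Tm.var _ (1 : Fin 2), Tm.const _]
    exact ((hM k hk1).zf k hk1 le_rfl).coll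
      (fun x y => Holds E (fun _ : Unit => lt) I φ (Fin.cons x (Fin.cons y z))) v hv

theorem mem_definableClasses {B U : Type} {R : B → M → M → Prop} {P : U → Set M} {X : Set M} :
    X ∈ definableClasses E R P ↔ Dfn E R P Set.univ (fun v : Fin 1 → M => v 0 ∈ X) :=
  ⟨fun h => ⟨h⟩, fun h => h.out⟩

/-- The definable classes of a model of `ZF` with a global well-order form a model of `GBC`. -/
theorem ModelsZF.modelsGBC {U : Type} {P : U → Set M} (h : ModelsZF E (fun _ : Unit => lt) P)
    (hlt : GlobalWellOrder E lt) : ModelsGBC E (definableClasses E (fun _ : Unit => lt) P) := by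
  have comp : ∀ {α U' : Type} (φ : (lang Empty U').Formula α) (C : U' → Set M),
      (∀ u, C u ∈ definableClasses E (fun _ : Unit => lt) P) →
      Dfn E (fun _ : Unit => lt) P Set.univ
        (fun v => Holds E (Empty.elim : Empty → M → M → Prop) C φ v) := by
    intro α U' φ C hC
    exact Filter.eventually_pure.1 <| Dfn.interp_formula (ι := Unit) (𝓕 := pure ())
      (P := fun _ => P) (fun b => b.elim)
      (fun u => .of_forall fun _ => mem_definableClasses.1 (hC u)) φ
  refine ⟨⟨h.basic, fun n φ y v => ?_, fun n φ z v hv => ?_⟩, fun m n φ C y hC => ?_,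
    fun X hX hne => ?_, fun F hF hfun a => ?_, ?_⟩
  · have : Dfn E (fun _ : Unit => lt) P Set.univ (fun v : Fin 1 → M =>
        Holds E (Empty.elim : Empty → M → M → Prop) (Empty.elim : Empty → Set M) φ
          (Fin.cons (v 0) y)) := by
      refine .congr ?_ ((comp φ Empty.elim fun u => u.elim).subst (α := Fin 1)
        (fun c v => (Fin.cons (v 0) y : Fin (n + 1) → M) c) ?_)
      · exact fun v => Iff.rfl
      · refine Fin.cases ?_ fun i => ?_
        exacts [Tm.var _ _, Tm.const _]
    exact h.sep (fun x => Holds E (Empty.elim : Empty → M → M → Prop)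
      (Empty.elim : Empty → Set M) φ (Fin.cons x y)) v
  · have : Dfn E (fun _ : Unit => lt) P Set.univ (fun v : Fin 2 → M =>
        Holds E (Empty.elim : Empty → M → M → Prop) (Empty.elim : Empty → Set M) φ
          (Fin.cons (v 0) (Fin.cons (v 1) z))) := by
      refine .congr ?_ ((comp φ Empty.elim fun u => u.elim).subst (α := Fin 2)
        (fun c v => (Fin.cons (v 0) (Fin.cons (v 1) z : Fin (n + 1) → M) : Fin (n + 2) → M) c) ?_)
      · exact fun v => Iff.rfl
      · refine Fin.cases ?_ (Fin.cases ?_ fun i => ?_)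
        exacts [Tm.var _ _, Tm.var _ (1 : Fin 2), Tm.const _]
    exact h.coll (fun x y => Holds E (Empty.elim : Empty → M → M → Prop)
      (Empty.elim : Empty → Set M) φ (Fin.cons x (Fin.cons y z))) v hv
  · refine mem_definableClasses.2 (.congr ?_ ((comp φ C hC).subst (α := Fin 1)
      (fun c v => (Fin.cons (v 0) y : Fin (n + 1) → M) c) ?_))
    · exact fun v => Iff.rfl
    · refine Fin.cases ?_ fun i => ?_
      exacts [Tm.var _ _, Tm.const _]
  · have := mem_definableClasses.1 hX
    exact h.exists_minimal (fun x => x ∈ X) hne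
  · have instF : ∀ {α : Type} (f g : (α → M) → M) [Tm Set.univ f] [Tm Set.univ g],
      Dfn E (fun _ : Unit => lt) P Set.univ (fun v => ClassRel E F (f v) (g v)) :=
        fun f g => (Dfn.classRel (mem_definableClasses.1 hF)).subst₂ f g
    -- Collection requires a value at every point, so `a` is first cut down to the domain of `F`.
    obtain ⟨a', ha'⟩ := h.sep (fun x => ∃ y, ClassRel E F x y) a
    obtain ⟨W, hW⟩ := h.coll (fun x y => ClassRel E F x y) a' fun x hx => ((ha' x).1 hx).2
    obtain ⟨b, hb⟩ := h.sep (fun y => ∃ x, E x a ∧ ClassRel E F x y) W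
    refine ⟨b, fun y => (hb y).trans ⟨fun hy => hy.2, fun hy => ⟨?_, hy⟩⟩⟩
    obtain ⟨x, hx, hxy⟩ := hy
    obtain ⟨y', hy', hxy'⟩ := hW x ((ha' x).2 ⟨hx, y, hxy⟩)
    exact hfun x y y' hxy hxy' ▸ hy'
  · let F : Set M := {p | ∃ x y, IsPair E x y p ∧ E y x ∧ ∀ z, E z x → z = y ∨ lt y z}
    have hF : ∀ x y, ClassRel E F x y ↔ E y x ∧ ∀ z, E z x → z = y ∨ lt y z := by
      intro x y
      constructor
      · rintro ⟨p, ⟨x', y', hp, h1⟩, hp'⟩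
        obtain ⟨rfl, rfl⟩ := h.basic.isPair_inj hp hp'
        exact h1
      · intro h1
        obtain ⟨p, hp⟩ := h.basic.exists_isPair x y
        exact ⟨p, ⟨x, y, hp, h1⟩, hp⟩
    refine ⟨F, mem_definableClasses.2 (inferInstanceAs (Dfn E (fun _ : Unit => lt) P Set.univ
      (fun v : Fin 1 → M => ∃ x y, IsPair E x y (v 0) ∧ E y x ∧ ∀ z, E z x → z = y ∨ lt y z))),
      fun x y y' hy hy' => ?_, fun x hx => ?_⟩
    · rw [hF] at hy hy'
      rcases hy.2 y' hy'.1 with e | e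
      · exact e.symm
      · rcases hy'.2 y hy.1 with e' | e'
        · exact e'
        · exact absurd (hlt.trans _ _ _ e e') (hlt.irrefl _)
    · obtain ⟨y, hy, hy'⟩ := hlt.least x hx
      exact ⟨y, hy, (hF x y).2 ⟨hy, hy'⟩⟩

theorem ModelsZFIomega.ordWeaklyCompact (hM : ModelsZFIomega E lt I) :
    OrdWeaklyCompact E (definableClasses E (fun _ : Unit => lt) I) := by
  intro τ hτ r hr ht
  obtain ⟨k, hτk, hrk⟩ := ((mem_definableClasses.1 hτ).eventually_reduct.and
    (mem_definableClasses.1 hr).eventually_reduct).exists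
  -- The tree uses only `I j` with `j < k`, so the next class `I k` is indiscernible for its
  -- structure; the axioms about `I k` first appear at stage `k + 1`.
  have hk := hM (k + 1) (by omega)
  obtain ⟨b, hb, hb'⟩ := hM.modelsZF.exists_branch hk.globalWellOrder
    (hk.cofinal k (by omega)) (hk.indiscernible k (by omega)) (fun i => Dfn.un_var (P := I) i)
    (Dfn.un_var (P := I) k) hτk (Dfn.classRel hrk) ht
  exact ⟨b, mem_definableClasses.2 hb, hb'⟩

end Main

end ZFIndis

theorem theorem4p7 {M : Type*} (E lt : M → M → Prop) (I : ℕ → Set M)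
    (hM : ZFIndis.ModelsZFIomega E lt I) :
    ZFIndis.ModelsGBC E (ZFIndis.definableClasses E (fun _ : Unit => lt) I) ∧
      ZFIndis.OrdWeaklyCompact E (ZFIndis.definableClasses E (fun _ : Unit => lt) I) :=
  ⟨hM.modelsZF.modelsGBC (hM 1 le_rfl).globalWellOrder, hM.ordWeaklyCompact⟩
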